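/- Let $K$ be an algebraically closed field of characteristic $0$ (for instance $K=\mathbb C$), let $R=K[x_1,\dots,x_n]$, and let $I\subset R$ be an ideal with zero set $X=V(I)\subset K^n$. Put $\operatorname{VAss}(I)=\{V(P) : P\in\operatorname{Ass}(R/I)\}$; its elements are the components of $I$. A component is isolated if it is maximal in $\operatorname{VAss}(I)$ with respect to inclusion, and embedded otherwise. For generators $f_1,\dots,f_N$ of $I$ and $d\ge 0$, let $A^{(d)}$ be the matrix with rows indexed by the products $x^\alpha f_j$ with $|\alpha|<d$, $1\le j\le N$, columns indexed by the multi-indices $\beta\in\mathbb N^n$ with $|\beta|\le d$, and entries $\partial^\beta(x^\alpha f_j)$. Let $a=(a_\beta)_{|\beta|\le d}$ be indeterminates. The deflation ideal $I^{(d)}\subset K[x,a]$ of order $d$ is generated by $f_1,\dots,f_N$ and the entries of $A^{(d)}a^T$; the deflated variety is $X^{(d)}=V(I^{(d)})$, and $\pi_d:X^{(d)}\to X$, $(x,a)\mapsto x$, is the projection, whose fibres are vector spaces. For $Y\in\operatorname{VAss}(I)$, let the generic locus $Y^\circ$ (at order $d$) be the set of the smooth points of $Y$ that lie on no component in $\operatorname{VAss}(I)$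 that does not contain $Y$, and at which the restriction $\pi_d^{-1}(Y)\to Y$ is locally trivial as a vector bundle (it has a frame of regular sections over a Zariski-open neighbourhood of the point in $Y$). The deflation of $Y$ of order $d$ is the Zariski closure $Y^{(d)}=\overline{\pi_d^{-1}(Y^\circ)}$, and $Y$ is visible at order $d$ if $Y^{(d)}$ is an isolated component of $X^{(d)}$, that is, a maximal element of $\operatorname{VAss}(I^{(d)})$. Theorem. Every component $Y\in\operatorname{VAss}(I)$, isolated or embedded, is visible at some order: there is $d\ge0$ such that, for every choice of generators $f_1,\dots,f_N$ of $I$, the deflation $Y^{(d)}$ is an isolated component of $X^{(d)}$; moreover $\pi_d(Y^{(d)})=Y$. In particular, every embedded component of $I$ is the projection of an isolated component of some deflation ideal of $I$. -/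

import Mathlib

open MvPolynomial

noncomputable section

namespace Deflation

variable {K : Type*} [Field K]

/-- Multi-indices `β ∈ ℕⁿ` with `|β| ≤ d`; they index the operators `∂^β` of order at most `d`. -/
abbrev OpIndex (n d : ℕ) : Type := {β : Fin n →₀ ℕ // β.degree ≤ d}

instance (n d : ℕ) : Fintype (OpIndex n d) := (Finsupp.finite_of_degree_le d).fintype

/-- The operator `∂^β = ∂₁^{β₁} ⋯ ∂ₙ^{βₙ}` on `K[x₁, …, xₙ]`. -/
def partialOp {n : ℕ} (β : Fin n →₀ ℕ) : Module.End K (MvPolynomial (Fin n) K) :=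
  ((List.finRange n).map fun i =>
    ((pderiv i : Derivation K (MvPolynomial (Fin n) K) (MvPolynomial (Fin n) K)).toLinearMap :
      Module.End K (MvPolynomial (Fin n) K)) ^ β i).prod

/-- The deflation matrix of order `d`: rows are indexed by `x^α f_j` with `|α| < d`, columns by
`∂^β` with `|β| ≤ d`, and the entry is `∂^β (x^α f_j)`. -/
def deflationMatrix {n N : ℕ} (f : Fin N → MvPolynomial (Fin n) K) (d : ℕ) :
    Matrix ({α : Fin n →₀ ℕ // α.degree < d} × Fin N) (OpIndex n d) (MvPolynomial (Fin n) K) :=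
  Matrix.of fun r β => partialOp β.1 (monomial r.1.1 1 * f r.2)

/-- The deflation ideal of order `d` in `K[x, a]`, where `a = (a_β)`, `|β| ≤ d`: it is generated by
the `f_j` and the entries of the vector `A a`, where `A` is the deflation matrix. -/
def deflationIdeal {n N : ℕ} (f : Fin N → MvPolynomial (Fin n) K) (d : ℕ) :
    Ideal (MvPolynomial (Fin n ⊕ OpIndex n d) K) :=
  Ideal.span
    (Set.range (fun j => rename Sum.inl (f j)) ∪
      Set.range (((deflationMatrix f d).map (rename Sum.inl)).mulVec fun β => X (Sum.inr β)))

/-- The deflated variety of order `d`. -/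
def deflatedVariety {n N : ℕ} (f : Fin N → MvPolynomial (Fin n) K) (d : ℕ) :
    Set (Fin n ⊕ OpIndex n d → K) :=
  zeroLocus K (deflationIdeal f d)

/-- The projection `(x, a) ↦ x`. -/
def proj (n d : ℕ) (p : Fin n ⊕ OpIndex n d → K) : Fin n → K := fun i => p (Sum.inl i)

/-- The components associated to an ideal: the zero sets of its associated primes. -/
def VAss {σ : Type*} (J : Ideal (MvPolynomial σ K)) : Set (Set (σ → K)) :=
  {Y | ∃ P ∈ associatedPrimes (MvPolynomial σ K) (MvPolynomial σ K ⧸ J), Y = zeroLocus K P}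

/-- An isolated component: one that is maximal with respect to inclusion. -/
def IsIsolatedComponent {σ : Type*} (J : Ideal (MvPolynomial σ K)) (Y : Set (σ → K)) : Prop :=
  Maximal (fun Z => Z ∈ VAss J) Y

/-- Zariski closure. -/
def zariskiClosure {σ : Type*} (S : Set (σ → K)) : Set (σ → K) :=
  zeroLocus K (vanishingIdeal K S)

/-- `y` is a smooth point of the variety `Y`: the coordinate ring of `Y` is smooth over `K` at the
maximal ideal of `y`. -/
def IsSmoothPoint {σ : Type*} (Y : Set (σ → K)) (y : σ → K) : Prop :=
  ∃ q ∈ Algebra.smoothLocus K (MvPolynomial σ K ⧸ vanishingIdeal K Y),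
    q.asIdeal.comap (Ideal.Quotient.mk (vanishingIdeal K Y)) = vanishingIdeal K {y}

/-- The restriction to `Y` of the deflated variety is a trivial vector bundle near `y`: on the
trace on `Y` of some basic Zariski-open neighbourhood `{h ≠ 0}` of `y` there is a frame of
regular sections, that is, vectors of polynomials whose values at each point form a basis of the
fibre. -/
def IsLocallyTrivialAt {n N : ℕ} (f : Fin N → MvPolynomial (Fin n) K) (d : ℕ)
    (Y : Set (Fin n → K)) (y : Fin n → K) : Prop :=
  ∃ h : MvPolynomial (Fin n) K, eval y h ≠ 0 ∧
    ∃ (r : ℕ) (s : Fin r → OpIndex n d → MvPolynomial (Fin n) K),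
      ∀ z ∈ Y, eval z h ≠ 0 →
        LinearIndependent K (fun k β => eval z (s k β)) ∧
        (Submodule.span K (Set.range fun k β => eval z (s k β)) : Set (OpIndex n d → K)) =
          {a | Sum.elim z a ∈ deflatedVariety f d}

/-- The generic locus of a component `Y` at order `d`: the smooth points of `Y` that lie on no
component that does not contain `Y`, and over which the deflated variety, restricted to `Y`, is
locally trivial. -/
def genericLocus {n N : ℕ} (f : Fin N → MvPolynomial (Fin n) K) (d : ℕ)
    (Y : Set (Fin n → K)) : Set (Fin n → K) :=
  {y | y ∈ Y ∧ IsSmoothPoint Y y ∧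
    (∀ Z ∈ VAss (Ideal.span (Set.range f)), ¬ Y ⊆ Z → y ∉ Z) ∧
    IsLocallyTrivialAt f d Y y}

/-- The deflation of order `d` of the component `Y`: the Zariski closure of the preimage of the
generic locus under the projection from the deflated variety. -/
def componentDeflation {n N : ℕ} (f : Fin N → MvPolynomial (Fin n) K) (d : ℕ)
    (Y : Set (Fin n → K)) : Set (Fin n ⊕ OpIndex n d → K) :=
  zariskiClosure {p | p ∈ deflatedVariety f d ∧ proj n d p ∈ genericLocus f d Y}

/-- `Y` is visible at order `d`: its deflation is an isolated component of the deflated variety. -/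
def IsVisibleAt {n N : ℕ} (f : Fin N → MvPolynomial (Fin n) K) (d : ℕ)
    (Y : Set (Fin n → K)) : Prop :=
  IsIsolatedComponent (deflationIdeal f d) (componentDeflation f d Y)

end Deflation

end

/-! An associated prime of `I` has the form `P = (I : g)`. Over a zero `x` of `I`, the fibre of the
deflated variety is the space of operators of order at most `d` at `x` that kill `I`
(`mem_deflatedVariety_iff_opFunctional`). The polynomial `G = ∑ a_β ∂^β g` detects `V(P)`: if `p ∈
P` and `p(x) ≠ 0`, then `p g ∈ I` forces every operator in the fibre over `x` to kill `g`, so `p G`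
vanishes on the deflated variety. Hence, if `G` is not identically zero on the deflation of `V(P)`,
every irreducible closed subset of the deflated variety that contains this deflation lies over
`V(P)`. Over the dense generic locus there is nothing there but a vector bundle, whose closure is
irreducible, so the deflation is a maximal irreducible subset (`mem_minimalPrimes_deflationIdeal`).

What remains is an operator along `V(P)` that kills `I` but not `g` (`exists_operator_separating`).
Let `L` be the fraction field of `K[x]/P` and `m` the maximal ideal of the generic point in `L[x]`.
If `g` lay in `I L[x] + m^(d+1)` for all `d`, Krull's intersection theorem would give `r ∈ m` with
`(1 - r) g ∈ I L[x]`. Applying `K`-linear functionals on `L` to coefficients moves this relation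
into `K[x]`, and `(I : g) ⊆ P` then makes `1 - r` vanish at the generic point, which is absurd. So
for some `d` a linear functional kills `I L[x] + m^(d+1)` but not `g`; by Taylor expansion it is an
operator of order at most `d`, and clearing denominators makes its coefficients polynomial. -/

open MvPolynomial

noncomputable section

namespace Deflation

/-! ### Taylor expansion and the operators `∂^β` -/

section Taylor

variable {F : Type*} [Field F] {n : ℕ}

/-- The substitution `X ↦ X + x`. -/
def translate (x : Fin n → F) : MvPolynomial (Fin n) F →ₐ[F] MvPolynomial (Fin n) F :=
  aeval fun i => X i + C (x i)

lemma translate_neg_translate (x : Fin n → F) (p : MvPolynomial (Fin n) F) :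
    translate (-x) (translate x p) = p := by
  have : (translate (-x)).comp (translate x) = AlgHom.id F _ := by
    ext i
    simp [translate]
  exact DFunLike.congr_fun this p

lemma translate_translate_neg (x : Fin n → F) (p : MvPolynomial (Fin n) F) :
    translate x (translate (-x) p) = p := by
  simpa using translate_neg_translate (-x) p

lemma coeff_zero_translate (x : Fin n → F) (p : MvPolynomial (Fin n) F) :
    coeff 0 (translate x p) = eval x p := by
  have : (constantCoeff : MvPolynomial (Fin n) F →+* F).comp (translate x).toRingHom = eval x := by
    ext i <;> simp [translate]
  simpa [constantCoeff_eq] using DFunLike.congr_fun this p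

lemma pderiv_translate (x : Fin n → F) (i : Fin n) (p : MvPolynomial (Fin n) F) :
    pderiv i (translate x p) = translate x (pderiv i p) := by
  classical
  induction p using MvPolynomial.induction_on with
  | C a => simp [translate]
  | add p q hp hq => simp [hp, hq]
  | mul_X p j hp =>
    simp only [map_mul, Derivation.leibniz, smul_eq_mul, hp, map_add]
    have hj : translate x (X j) = X j + C (x j) := by simp [translate]
    rw [hj, map_add, pderiv_C, add_zero, pderiv_X]
    by_cases h : j = i
    · subst h; simp
    · simp [Ne.symm h]

lemma pderiv_pow_translate (x : Fin n → F) (i : Fin n) (k : ℕ) (p : MvPolynomial (Fin n) F) :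
    ((pderiv i : Derivation F (MvPolynomial (Fin n) F) _).toLinearMap ^ k) (translate x p) =
      translate x (((pderiv i : Derivation F (MvPolynomial (Fin n) F) _).toLinearMap ^ k) p) := by
  induction k generalizing p with
  | zero => simp
  | succ k ih =>
    rw [pow_succ, Module.End.mul_apply, Module.End.mul_apply]
    simp only [Derivation.coeFn_coe, pderiv_translate, ih]

lemma partialOp_translate (x : Fin n → F) (β : Fin n →₀ ℕ) (p : MvPolynomial (Fin n) F) :
    partialOp β (translate x p) = translate x (partialOp β p) := by
  unfold partialOp
  induction List.finRange n with
  | nil => simp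
  | cons i l ih =>
    simp only [List.map_cons, List.prod_cons, Module.End.mul_apply, ih, pderiv_pow_translate]

lemma map_partialOp {E : Type*} [Field E] (φ : F →+* E) (β : Fin n →₀ ℕ)
    (p : MvPolynomial (Fin n) F) : partialOp β (map φ p) = map φ (partialOp β p) := by
  have hpow (i : Fin n) (k : ℕ) (q : MvPolynomial (Fin n) F) :
      ((pderiv i : Derivation E (MvPolynomial (Fin n) E) _).toLinearMap ^ k) (map φ q) =
        map φ (((pderiv i : Derivation F (MvPolynomial (Fin n) F) _).toLinearMap ^ k) q) := by
    induction k generalizing q with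
    | zero => simp
    | succ k ih =>
      rw [pow_succ, Module.End.mul_apply, pow_succ, Module.End.mul_apply]
      simp only [Derivation.coeFn_coe, pderiv_map, ih]
  unfold partialOp
  induction List.finRange n with
  | nil => simp
  | cons i l ih =>
    simp only [List.map_cons, List.prod_cons, Module.End.mul_apply, ih, hpow]

lemma totalDegree_translate_le (x : Fin n → F) (p : MvPolynomial (Fin n) F) :
    (translate x p).totalDegree ≤ p.totalDegree := by
  rw [translate, aeval_def, eval₂_eq]
  refine totalDegree_finsetSum_le fun α hα => (totalDegree_mul _ _).trans ?_
  rw [algebraMap_eq, totalDegree_C, zero_add]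
  refine (totalDegree_finsetProd _ _).trans (le_trans ?_ (le_totalDegree hα))
  rw [Finsupp.sum]
  refine Finset.sum_le_sum fun i _ => (totalDegree_pow _ _).trans ?_
  have : (X i + C (x i) : MvPolynomial (Fin n) F).totalDegree ≤ 1 := by
    refine (totalDegree_add _ _).trans ?_
    simp
  exact (Nat.mul_le_mul_left _ this).trans (mul_one _).le

variable [CharZero F]

/-- The constant is `(m i + 1) ⋯ (m i + k)`, non-zero in characteristic zero. Only its non-vanishing
matters later. -/
lemma exists_coeff_pderiv_pow (i : Fin n) (k : ℕ) (m : Fin n →₀ ℕ) :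
    ∃ c : F, c ≠ 0 ∧ ∀ p : MvPolynomial (Fin n) F,
      coeff m (((pderiv i : Derivation F (MvPolynomial (Fin n) F) _).toLinearMap ^ k) p) =
        c * coeff (m + Finsupp.single i k) p := by
  induction k generalizing m with
  | zero => exact ⟨1, one_ne_zero, fun p => by simp⟩
  | succ k ih =>
    obtain ⟨c, hc, h⟩ := ih (m + Finsupp.single i 1)
    refine ⟨(m i + 1) * c, mul_ne_zero (Nat.cast_add_one_ne_zero _) hc, fun p => ?_⟩
    rw [pow_succ', Module.End.mul_apply, Derivation.coeFn_coe, coeff_pderiv, h, add_assoc,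
      ← Finsupp.single_add, add_comm 1 k]
    ring

lemma exists_coeff_partialOp (β : Fin n →₀ ℕ) :
    ∃ c : F, c ≠ 0 ∧ ∀ p : MvPolynomial (Fin n) F,
      coeff 0 (partialOp β p) = c * coeff β p := by
  -- `partialOp` is a product over a list; the induction needs an arbitrary list and an arbitrary
  -- exponent `m`, since each factor shifts `m`.
  have key (l : List (Fin n)) (m : Fin n →₀ ℕ) :
      ∃ c : F, c ≠ 0 ∧ ∀ p : MvPolynomial (Fin n) F,
        coeff m ((l.map fun i =>
          ((pderiv i : Derivation F (MvPolynomial (Fin n) F) _).toLinearMap :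
            Module.End F (MvPolynomial (Fin n) F)) ^ β i).prod p) =
          c * coeff (m + (l.map fun i => Finsupp.single i (β i)).sum) p := by
    induction l generalizing m with
    | nil => exact ⟨1, one_ne_zero, fun p => by simp⟩
    | cons i l ih =>
      obtain ⟨c, hc, h⟩ := exists_coeff_pderiv_pow (F := F) i (β i) m
      obtain ⟨c', hc', h'⟩ := ih (m + Finsupp.single i (β i))
      refine ⟨c * c', mul_ne_zero hc hc', fun p => ?_⟩
      rw [List.map_cons, List.prod_cons, Module.End.mul_apply, h, h', List.map_cons,
        List.sum_cons, add_assoc, mul_assoc]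
  obtain ⟨c, hc, h⟩ := key (List.finRange n) 0
  refine ⟨c, hc, fun p => ?_⟩
  have hsum : ((List.finRange n).map fun i => Finsupp.single i (β i)).sum = β := by
    rw [← List.ofFn_eq_map, List.sum_ofFn, Finsupp.univ_sum_single]
  rw [partialOp, h p, hsum, zero_add]

lemma exists_eval_partialOp (x : Fin n → F) (β : Fin n →₀ ℕ) :
    ∃ c : F, c ≠ 0 ∧ ∀ p : MvPolynomial (Fin n) F,
      eval x (partialOp β p) = c * coeff β (translate x p) := by
  obtain ⟨c, hc, h⟩ := exists_coeff_partialOp (F := F) β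
  exact ⟨c, hc, fun p => by rw [← coeff_zero_translate, ← partialOp_translate, h]⟩

/-- Taylor: the `k`-th power of the maximal ideal of `x` consists of the polynomials all of whose
derivatives of order less than `k` vanish at `x`. -/
lemma mem_ker_eval_pow_iff (x : Fin n → F) (k : ℕ) (p : MvPolynomial (Fin n) F) :
    p ∈ RingHom.ker (eval x) ^ k ↔
      ∀ β : Fin n →₀ ℕ, β.degree < k → eval x (partialOp β p) = 0 := by
  have hmem (q : MvPolynomial (Fin n) F) : q ∈ idealOfVars (Fin n) F ↔ coeff 0 q = 0 := by
    have := mem_pow_idealOfVars_iff' 1 q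
    rw [pow_one] at this
    simp [this, Finsupp.degree_eq_zero_iff]
  have h₁ : (RingHom.ker (eval x)).map (translate x) ≤ idealOfVars (Fin n) F := by
    rw [Ideal.map_le_iff_le_comap]
    intro q hq
    rw [Ideal.mem_comap, hmem, coeff_zero_translate]
    exact hq
  have h₂ : (idealOfVars (Fin n) F).map (translate (-x)) ≤ RingHom.ker (eval x) := by
    rw [Ideal.map_le_iff_le_comap]
    intro q hq
    rw [Ideal.mem_comap, RingHom.mem_ker, ← coeff_zero_translate, translate_translate_neg]
    exact (hmem q).1 hq
  have h : p ∈ RingHom.ker (eval x) ^ k ↔ translate x p ∈ idealOfVars (Fin n) F ^ k := by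
    refine ⟨fun hp => ?_, fun hp => ?_⟩
    · have := Ideal.mem_map_of_mem (translate x) hp
      rw [Ideal.map_pow] at this
      exact Ideal.pow_right_mono h₁ k this
    · have := Ideal.mem_map_of_mem (translate (-x)) hp
      rw [Ideal.map_pow, translate_neg_translate] at this
      exact Ideal.pow_right_mono h₂ k this
  rw [h, mem_pow_idealOfVars_iff']
  refine forall₂_congr fun β _ => ?_
  obtain ⟨c, hc, hβ⟩ := exists_eval_partialOp x β
  simp [hβ, hc]

/-- Every polynomial agrees modulo the `k`-th power of the maximal ideal of `x` with one of
degree less than `k`. -/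
lemma exists_sub_mem_ker_eval_pow (x : Fin n → F) (k : ℕ) (p : MvPolynomial (Fin n) F) :
    ∃ q : MvPolynomial (Fin n) F, (∀ α ∈ q.support, α.degree < k) ∧
      p - q ∈ RingHom.ker (eval x) ^ k := by
  classical
  -- The Taylor polynomial of `p` at `x`, cut off below degree `k` and written in the translated
  -- coordinates.
  set t : MvPolynomial (Fin n) F :=
    ∑ α ∈ (translate x p).support with α.degree < k, monomial α (coeff α (translate x p)) with ht
  have hcoeff (α : Fin n →₀ ℕ) (hα : α.degree < k) : coeff α t = coeff α (translate x p) := by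
    rw [ht, coeff_sum]
    simp only [coeff_monomial, Finset.sum_ite_eq']
    split_ifs with h
    · rfl
    · simp only [Finset.mem_filter, mem_support_iff, not_and] at h
      by_contra hne
      exact h (Ne.symm hne) hα
  refine ⟨translate (-x) t, fun α hα => ?_, ?_⟩
  · rcases k.eq_zero_or_pos with rfl | hk
    · simp [ht] at hα
    have h₁ : α.degree ≤ (translate (-x) t).totalDegree := le_totalDegree hα
    have h₂ : t.totalDegree ≤ k - 1 := by
      refine totalDegree_finsetSum_le fun β hβ => (totalDegree_monomial_le _ _).trans ?_
      have := (Finset.mem_filter.1 hβ).2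
      change β.degree ≤ k - 1
      lia
    have := totalDegree_translate_le (-x) t
    lia
  · rw [mem_ker_eval_pow_iff]
    intro β hβ
    obtain ⟨c, -, h⟩ := exists_eval_partialOp x β
    rw [h, map_sub, translate_translate_neg, coeff_sub, hcoeff β hβ, sub_self, mul_zero]

end Taylor

/-! ### Operators of bounded order at a point and the fibres of the deflated variety -/

section Functional

variable {F : Type*} [Field F] {n d : ℕ}

/-- The functional `p ↦ ∑ a_β (∂^β p)(x)`. -/
def opFunctional (x : Fin n → F) (a : OpIndex n d → F) : MvPolynomial (Fin n) F →ₗ[F] F :=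
  ∑ β, a β • (aeval x).toLinearMap ∘ₗ partialOp β.1

lemma opFunctional_apply (x : Fin n → F) (a : OpIndex n d → F) (p : MvPolynomial (Fin n) F) :
    opFunctional x a p = ∑ β, a β * eval x (partialOp β.1 p) := by
  simp [opFunctional, LinearMap.sum_apply, aeval_eq_eval]

variable [CharZero F]

lemma opFunctional_eq_zero_of_mem (x : Fin n → F) (a : OpIndex n d → F)
    {p : MvPolynomial (Fin n) F} (hp : p ∈ RingHom.ker (eval x) ^ (d + 1)) :
    opFunctional x a p = 0 := by
  rw [opFunctional_apply]
  refine Finset.sum_eq_zero fun β _ => ?_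
  rw [(mem_ker_eval_pow_iff x _ p).1 hp β.1 (Nat.lt_succ_of_le β.2), mul_zero]

/-- Functionals that vanish on the `(d+1)`-st power of the maximal ideal of `x` are given by
operators of order at most `d`. -/
lemma exists_eq_opFunctional (x : Fin n → F) (ψ : MvPolynomial (Fin n) F →ₗ[F] F)
    (hψ : ∀ p ∈ RingHom.ker (eval x) ^ (d + 1), ψ p = 0) :
    ∃ a : OpIndex n d → F, ψ = opFunctional x a := by
  -- By Taylor, the common kernel of the finitely many functionals `p ↦ (∂^β p)(x)` is the power on
  -- which `ψ` vanishes, so `ψ` lies in their span.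
  have hmem := mem_span_of_iInf_ker_le_ker (K := ψ)
    (L := fun β : OpIndex n d => (aeval x).toLinearMap ∘ₗ partialOp (K := F) β.1) fun p hp =>
      hψ p <| (mem_ker_eval_pow_iff x _ p).2 fun β hβ => by
        simpa [aeval_eq_eval] using (Submodule.mem_iInf _).1 hp ⟨β, Nat.le_of_lt_succ hβ⟩
  obtain ⟨a, ha⟩ := (Submodule.mem_span_range_iff_exists_fun F).1 hmem
  exact ⟨a, ha.symm⟩

/-- An operator of order at most `d` at a point of the zero set of `f` that kills the products
`x^α f_j` with `|α| < d` kills the whole ideal. -/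
lemma opFunctional_eq_zero_of_mem_span {N : ℕ} (f : Fin N → MvPolynomial (Fin n) F)
    (x : Fin n → F) (a : OpIndex n d → F) (hx : ∀ j, eval x (f j) = 0)
    (ha : ∀ (α : Fin n →₀ ℕ) (j : Fin N), α.degree < d →
      opFunctional x a (monomial α 1 * f j) = 0)
    {p : MvPolynomial (Fin n) F} (hp : p ∈ Ideal.span (Set.range f)) :
    opFunctional x a p = 0 := by
  obtain ⟨c, rfl⟩ := (Ideal.mem_span_range_iff_exists_fun).1 hp
  rw [map_sum]
  refine Finset.sum_eq_zero fun j _ => ?_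
  -- Multipliers of degree below `d` suffice: the remainder `c j - q` vanishes to order `d`, and `f
  -- j` vanishes at `x`, so their product vanishes to order `d + 1`.
  obtain ⟨q, hq, hcq⟩ := exists_sub_mem_ker_eval_pow x d (c j)
  have h₁ : opFunctional x a ((c j - q) * f j) = 0 := by
    refine opFunctional_eq_zero_of_mem x a ?_
    rw [pow_succ]
    exact Ideal.mul_mem_mul hcq (hx j)
  have h₂ : opFunctional x a (q * f j) = 0 := by
    rw [q.as_sum, Finset.sum_mul, map_sum]
    refine Finset.sum_eq_zero fun α hα => ?_
    have : monomial α (coeff α q) * f j = coeff α q • (monomial α 1 * f j) := by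
      rw [← smul_mul_assoc, smul_monomial, smul_eq_mul, mul_one]
    rw [this, map_smul, ha α j (hq α hα), smul_zero]
  rw [← sub_add_cancel (c j) q, add_mul, map_add, h₁, h₂, add_zero]

end Functional

variable {K : Type*} [Field K] {n d N : ℕ}

lemma mem_deflatedVariety_iff (f : Fin N → MvPolynomial (Fin n) K) (x : Fin n → K)
    (a : OpIndex n d → K) :
    Sum.elim x a ∈ deflatedVariety f d ↔ (∀ j, eval x (f j) = 0) ∧
      ((deflationMatrix f d).map (eval x)).mulVec a = 0 := by
  have hren (p : MvPolynomial (Fin n) K) :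
      aeval (Sum.elim x a) (rename Sum.inl p) = eval x p := by
    rw [aeval_rename, Sum.elim_comp_inl, aeval_eq_eval]
  rw [deflatedVariety, deflationIdeal, zeroLocus_span]
  simp only [Set.mem_ofPred_eq, Set.mem_union, or_imp, forall_and, Set.forall_mem_range, hren]
  refine and_congr_right fun _ => ?_
  rw [funext_iff]
  refine forall_congr' fun r => ?_
  simp [Matrix.mulVec, dotProduct, eval_rename]

/-- The fibre of the deflated variety over a zero `x` of the ideal consists of the operators of
order at most `d` at `x` that kill the ideal. -/
lemma mem_deflatedVariety_iff_opFunctional [CharZero K] (f : Fin N → MvPolynomial (Fin n) K)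
    (x : Fin n → K) (a : OpIndex n d → K) :
    Sum.elim x a ∈ deflatedVariety f d ↔ (∀ j, eval x (f j) = 0) ∧
      ∀ p ∈ Ideal.span (Set.range f), opFunctional x a p = 0 := by
  rw [mem_deflatedVariety_iff]
  refine and_congr_right fun hx => ?_
  have hrow (r : {α : Fin n →₀ ℕ // α.degree < d} × Fin N) :
      ((deflationMatrix f d).map (eval x)).mulVec a r =
        opFunctional x a (monomial r.1.1 1 * f r.2) := by
    simp [opFunctional_apply, Matrix.mulVec, dotProduct, deflationMatrix, mul_comm]
  refine ⟨fun h p hp => opFunctional_eq_zero_of_mem_span f x a hx (fun α j hα => ?_) hp,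
    fun h => funext fun r => ?_⟩
  · rw [← hrow (⟨α, hα⟩, j), h, Pi.zero_apply]
  · rw [hrow, Pi.zero_apply]
    exact h _ (Ideal.mul_mem_left _ _ (Ideal.subset_span ⟨_, rfl⟩))

end Deflation

namespace Deflation

/-! ### An operator separating `g` from `I` along the component `(I : g)` -/

section CoeffFunctional

variable {σ K L : Type*} [Field K] [Field L] [Algebra K L]

/-- Apply a `K`-linear functional on `L` to the coefficients of a polynomial over `L`. -/
def mapCoeff (ℓ : L →ₗ[K] K) (p : MvPolynomial σ L) : MvPolynomial σ K :=
  ∑ m ∈ p.support, monomial m (ℓ (coeff m p))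

lemma coeff_mapCoeff (ℓ : L →ₗ[K] K) (p : MvPolynomial σ L) (m : σ →₀ ℕ) :
    coeff m (mapCoeff ℓ p) = ℓ (coeff m p) := by
  classical
  simp only [mapCoeff, coeff_sum, coeff_monomial, Finset.sum_ite_eq', mem_support_iff]
  split_ifs with h
  · rfl
  · rw [not_not.1 h, map_zero]

lemma mapCoeff_add (ℓ : L →ₗ[K] K) (p q : MvPolynomial σ L) :
    mapCoeff ℓ (p + q) = mapCoeff ℓ p + mapCoeff ℓ q := by
  ext m; simp [coeff_mapCoeff]

lemma mapCoeff_mul_map (ℓ : L →ₗ[K] K) (p : MvPolynomial σ L) (q : MvPolynomial σ K) :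
    mapCoeff ℓ (p * map (algebraMap K L) q) = mapCoeff ℓ p * q := by
  classical
  ext m
  simp only [coeff_mapCoeff, coeff_mul, map_sum, coeff_map]
  refine Finset.sum_congr rfl fun x _ => ?_
  rw [mul_comm, ← Algebra.smul_def, map_smul, smul_eq_mul, mul_comm]

lemma mapCoeff_mem (ℓ : L →ₗ[K] K) (I : Ideal (MvPolynomial σ K)) {p : MvPolynomial σ L}
    (hp : p ∈ I.map (map (algebraMap K L))) : mapCoeff ℓ p ∈ I := by
  -- `mapCoeff ℓ` is not linear over `L[x]`, so the induction on the span must carry an arbitrary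
  -- multiplier.
  suffices h : ∀ v, mapCoeff ℓ (v * p) ∈ I by simpa using h 1
  induction hp using Submodule.span_induction with
  | mem x hx =>
    obtain ⟨q, hq, rfl⟩ := hx
    intro v
    rw [mapCoeff_mul_map]
    exact I.mul_mem_left _ hq
  | zero =>
    intro v
    have : mapCoeff ℓ (v * 0) = 0 := by ext m; simp [coeff_mapCoeff]
    rw [this]
    exact I.zero_mem
  | add x y _ _ hx hy =>
    intro v
    rw [mul_add, mapCoeff_add]
    exact I.add_mem (hx v) (hy v)
  | smul a x _ hx =>
    intro v
    rw [smul_eq_mul, ← mul_assoc]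
    exact hx _

/-- If all coefficientwise functionals of `u` vanish at a point with coordinates in `L`, then so
does `u`. -/
lemma eval_eq_zero_of_mapCoeff (y : σ → L) (u : MvPolynomial σ L)
    (h : ∀ ℓ : L →ₗ[K] K, aeval y (mapCoeff ℓ u) = 0) : eval y u = 0 := by
  classical
  let b := Module.Basis.ofVectorSpace K L
  let T : Finset _ := u.support.biUnion fun m => (b.repr (coeff m u)).support
  -- Expanding the coefficients in a `K`-basis of `L` recovers `u` from its images under the
  -- coordinate functionals.
  have hu : u = ∑ i ∈ T, C (b i) * map (algebraMap K L) (mapCoeff (b.coord i) u) := by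
    ext m
    simp only [coeff_sum, coeff_C_mul, coeff_map, coeff_mapCoeff, Module.Basis.coord_apply]
    conv_lhs => rw [← b.linearCombination_repr (coeff m u), Finsupp.linearCombination_apply]
    rw [Finsupp.sum_of_support_subset (s := T)]
    · refine Finset.sum_congr rfl fun i _ => ?_
      rw [Algebra.smul_def, mul_comm]
    · by_cases hm : m ∈ u.support
      · exact Finset.subset_biUnion_of_mem (fun m => (b.repr (coeff m u)).support) hm
      · rw [notMem_support_iff.1 hm]; simp
    · simp
  rw [hu, map_sum]
  refine Finset.sum_eq_zero fun i _ => ?_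
  rw [map_mul, eval_map, ← aeval_def, h, mul_zero]

end CoeffFunctional

/-! ### Krull's intersection theorem at the generic point -/

section SeparatingOperator

variable {K : Type*} [Field K] {n : ℕ}

/-- The generic point of the zero set of a prime ideal. -/
def genericPoint (P : Ideal (MvPolynomial (Fin n) K)) [P.IsPrime] :
    Fin n → FractionRing (MvPolynomial (Fin n) K ⧸ P) :=
  fun i => algebraMap (MvPolynomial (Fin n) K ⧸ P) _ (Ideal.Quotient.mk P (X i))

lemma aeval_genericPoint (P : Ideal (MvPolynomial (Fin n) K)) [P.IsPrime]
    (p : MvPolynomial (Fin n) K) :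
    aeval (genericPoint P) p =
      algebraMap (MvPolynomial (Fin n) K ⧸ P) (FractionRing (MvPolynomial (Fin n) K ⧸ P))
        (Ideal.Quotient.mk P p) := by
  have : aeval (R := K) (genericPoint P) = (Algebra.algHom K (MvPolynomial (Fin n) K ⧸ P)
      (FractionRing (MvPolynomial (Fin n) K ⧸ P))).comp (Ideal.Quotient.mkₐ K P) := by
    ext i
    rw [aeval_X]
    rfl
  rw [this]
  rfl

lemma aeval_genericPoint_eq_zero_iff (P : Ideal (MvPolynomial (Fin n) K)) [P.IsPrime]
    (p : MvPolynomial (Fin n) K) : aeval (genericPoint P) p = 0 ↔ p ∈ P := by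
  rw [aeval_genericPoint, map_eq_zero_iff _ (IsFractionRing.injective _ _),
    Ideal.Quotient.eq_zero_iff_mem]

lemma exists_notMem_sup_ker_eval_pow (I P : Ideal (MvPolynomial (Fin n) K)) [P.IsPrime]
    (g : MvPolynomial (Fin n) K) (hg : ∀ u, u * g ∈ I → u ∈ P) :
    ∃ d : ℕ, map (algebraMap K (FractionRing (MvPolynomial (Fin n) K ⧸ P))) g ∉
      I.map (map (algebraMap K (FractionRing (MvPolynomial (Fin n) K ⧸ P)))) ⊔
        RingHom.ker (eval (genericPoint P)) ^ (d + 1) := by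
  set L := FractionRing (MvPolynomial (Fin n) K ⧸ P)
  set J := I.map (map (algebraMap K L))
  set m := RingHom.ker (eval (genericPoint P))
  by_contra! hd
  have hmem : Ideal.Quotient.mk J (map (algebraMap K L) g) ∈
      (⨅ i : ℕ, m ^ i • ⊤ : Submodule (MvPolynomial (Fin n) L) (MvPolynomial (Fin n) L ⧸ J)) := by
    refine (Submodule.mem_iInf _).2 fun i => ?_
    obtain ⟨a, ha, b, hb, hab⟩ := Submodule.mem_sup.1 (hd i)
    rw [← hab, map_add, Ideal.Quotient.eq_zero_iff_mem.2 ha, zero_add]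
    have : Ideal.Quotient.mk J b = b • (1 : MvPolynomial (Fin n) L ⧸ J) := by
      change _ = Ideal.Quotient.mk J (b • 1)
      rw [smul_eq_mul, mul_one]
    rw [this]
    exact Submodule.smul_mem_smul (Ideal.pow_le_pow_right (Nat.le_succ i) hb) trivial
  -- Krull: the class of `g` modulo `J` is fixed by some `r ∈ m`.
  obtain ⟨⟨r, hr⟩, h⟩ := (Ideal.mem_iInf_smul_pow_eq_bot_iff m _).1 hmem
  have hu : (1 - r) * map (algebraMap K L) g ∈ J := by
    rw [← Ideal.Quotient.eq_zero_iff_mem, sub_mul, one_mul, map_sub, sub_eq_zero]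
    exact h.symm
  have hzero : eval (genericPoint P) (1 - r) = 0 := by
    refine eval_eq_zero_of_mapCoeff (K := K) _ _ fun ℓ => ?_
    rw [aeval_genericPoint_eq_zero_iff]
    refine hg _ ?_
    rw [← mapCoeff_mul_map]
    exact mapCoeff_mem ℓ I hu
  rw [map_sub, map_one, (RingHom.mem_ker).1 hr, sub_zero] at hzero
  exact one_ne_zero hzero

/-- If `P = (I : g)` is a prime ideal, there is a differential operator with polynomial
coefficients that maps `I` into `P` but does not map `g` into `P`. -/
theorem exists_operator_separating [CharZero K] (I P : Ideal (MvPolynomial (Fin n) K)) [P.IsPrime]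
    (g : MvPolynomial (Fin n) K) (hg : ∀ u, u * g ∈ I → u ∈ P) :
    ∃ (d : ℕ) (s : OpIndex n d → MvPolynomial (Fin n) K),
      (∀ p ∈ I, ∑ β, s β * partialOp β.1 p ∈ P) ∧ ∑ β, s β * partialOp β.1 g ∉ P := by
  obtain ⟨d, hd⟩ := exists_notMem_sup_ker_eval_pow I P g hg
  set L := FractionRing (MvPolynomial (Fin n) K ⧸ P)
  have : CharZero L := charZero_of_injective_algebraMap (algebraMap K L).injective
  obtain ⟨ψ, hψg, hψ⟩ := Submodule.exists_le_ker_of_notMem (K := L)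
    (p := Submodule.restrictScalars L (I.map (map (algebraMap K L)) ⊔
        RingHom.ker (eval (genericPoint P)) ^ (d + 1))) hd
  obtain ⟨a, rfl⟩ := exists_eq_opFunctional (d := d) (genericPoint P) ψ fun p hp =>
    hψ (Ideal.mem_sup_right hp)
  -- A common denominator of the `a β`; scaling by it does not change which polynomials the
  -- functional kills.
  obtain ⟨b, hb⟩ := IsLocalization.exist_integer_multiples_of_finite
    (nonZeroDivisors (MvPolynomial (Fin n) K ⧸ P)) a
  choose c hc using hb
  choose s hs using fun β => Ideal.Quotient.mk_surjective (I := P) (c β)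
  have key (p : MvPolynomial (Fin n) K) : ∑ β, s β * partialOp β.1 p ∈ P ↔
      opFunctional (genericPoint P) a (map (algebraMap K L) p) = 0 := by
    have hb : algebraMap (MvPolynomial (Fin n) K ⧸ P) L b ≠ 0 :=
      IsFractionRing.to_map_ne_zero_of_mem_nonZeroDivisors b.2
    have heq : aeval (genericPoint P) (∑ β, s β * partialOp β.1 p) =
        algebraMap (MvPolynomial (Fin n) K ⧸ P) L b *
          opFunctional (genericPoint P) a (map (algebraMap K L) p) := by
      rw [opFunctional_apply, map_sum, Finset.mul_sum]
      refine Finset.sum_congr rfl fun β _ => ?_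
      rw [map_mul, aeval_genericPoint P (s β), hs, hc, Algebra.smul_def, map_partialOp, eval_map,
        ← aeval_def, mul_assoc]
    rw [← aeval_genericPoint_eq_zero_iff, heq, mul_eq_zero, or_iff_right hb]
  refine ⟨d, s, fun p hp => ?_, fun h => hψg ((key g).1 h)⟩
  exact (key p).2 (hψ (Ideal.mem_sup_left (Ideal.mem_map_of_mem _ hp)))

end SeparatingOperator

/-! ### Generic smoothness -/

section Smooth

variable {K : Type*} [Field K] [CharZero K]

/-- The function field is a finitely generated extension in characteristic zero, hence formally
smooth, so the generic point is in the smooth locus. That locus is open and so contains a basic open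
neighbourhood of the generic point. -/
lemma exists_isSmoothPoint {σ : Type*} [Finite σ] (Y : Set (σ → K))
    [hP : (vanishingIdeal K Y).IsPrime] :
    ∃ h ∉ vanishingIdeal K Y, ∀ y ∈ Y, eval y h ≠ 0 → IsSmoothPoint Y y := by
  set P := vanishingIdeal K Y
  let A := MvPolynomial σ K ⧸ P
  have : Algebra.FinitePresentation K A := Algebra.FinitePresentation.of_finiteType.1 inferInstance
  have : Algebra.EssFiniteType A (FractionRing A) :=
    .of_isLocalization _ (nonZeroDivisors A)
  have : Algebra.EssFiniteType K (FractionRing A) := .comp K A _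
  have hbot : (⟨⊥, Ideal.isPrime_bot⟩ : PrimeSpectrum A) ∈ Algebra.smoothLocus K A := by
    have hloc : IsLocalization (nonZeroDivisors A) (Localization.AtPrime (⊥ : Ideal A)) := by
      rw [← Ideal.primeCompl_bot]
      infer_instance
    have e : FractionRing A ≃ₐ[A] Localization.AtPrime (⊥ : Ideal A) :=
      IsLocalization.algEquiv (nonZeroDivisors A) _ _
    exact Algebra.FormallySmooth.of_equiv (e.restrictScalars K)
  obtain ⟨_, ⟨h, rfl⟩, hh, hsub⟩ :=
    PrimeSpectrum.isTopologicalBasis_basic_opens.exists_subset_of_mem_open hbot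
      Algebra.isOpen_smoothLocus
  obtain ⟨h, rfl⟩ := Ideal.Quotient.mk_surjective h
  refine ⟨h, fun hmem => hh ?_, fun y hy hyh => ?_⟩
  · simpa using Ideal.Quotient.eq_zero_iff_mem.2 hmem
  · let ε : A →+* K := Ideal.Quotient.lift P (eval y) fun p hp => by
      simpa [aeval_eq_eval] using hp y hy
    refine ⟨⟨RingHom.ker ε, RingHom.ker_isPrime ε⟩, hsub ?_, ?_⟩
    · exact hyh
    · ext p
      rw [mem_vanishingIdeal_singleton_iff, aeval_eq_eval]
      exact Iff.rfl

end Smooth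

/-! ### Generic frames of kernels -/

section Frame

lemma map_smul_one {R S κ : Type*} [CommRing R] [CommRing S] [DecidableEq κ] (φ : R →+* S)
    (c : R) : (c • (1 : Matrix κ κ R)).map φ = φ c • (1 : Matrix κ κ S) := by
  ext i j
  simp [Matrix.one_apply, apply_ite φ]

/-- The columns of `s` are a basis of the kernel and `t` is a retraction onto it. Matrix identities,
unlike a rank condition, survive both clearing denominators and specialization at points. -/
lemma exists_kernel_splitting {L ι κ : Type*} [Field L] [Fintype ι] [Fintype κ] [DecidableEq κ]
    (A : Matrix ι κ L) :
    ∃ (r : ℕ) (s : Matrix κ (Fin r) L) (t : Matrix (Fin r) κ L) (B : Matrix κ ι L),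
      t * s = 1 ∧ A * s = 0 ∧ s * t + B * A = 1 := by
  classical
  let W := LinearMap.ker A.mulVecLin
  let e := Module.finBasis L W
  let S : (Fin (Module.finrank L W) → L) →ₗ[L] κ → L :=
    W.subtype ∘ₗ e.equivFun.symm.toLinearMap
  have hS : LinearMap.ker S = ⊥ := LinearMap.ker_eq_bot.2
    (Subtype.val_injective.comp e.equivFun.symm.injective)
  obtain ⟨T, hT⟩ := S.exists_leftInverse_of_injective hS
  have hST (w : κ → L) (hw : A.mulVec w = 0) : S (T w) = w := by
    obtain ⟨v, rfl⟩ : ∃ v, S v = w := ⟨e.equivFun ⟨w, hw⟩, by simp [S]⟩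
    rw [show T (S v) = v from DFunLike.congr_fun hT v]
  -- Each coordinate of `id - S ∘ T` vanishes on the kernel of `A`, hence is a combination of the
  -- rows of `A`.
  have hB (k : κ) : ∃ b : ι → L,
      ∑ i, b i • (LinearMap.proj i ∘ₗ A.mulVecLin) =
        LinearMap.proj k ∘ₗ (LinearMap.id - S ∘ₗ T : (κ → L) →ₗ[L] κ → L) := by
    rw [← Submodule.mem_span_range_iff_exists_fun]
    refine mem_span_of_iInf_ker_le_ker fun w hw => ?_
    have : A.mulVec w = 0 := funext fun i => by simpa using (Submodule.mem_iInf _).1 hw i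
    simp [hST w this]
  choose B hB using hB
  refine ⟨_, S.toMatrix', T.toMatrix', Matrix.of B, ?_, ?_, ?_⟩
  · rw [← LinearMap.toMatrix'_comp, hT, LinearMap.toMatrix'_id]
  · refine Matrix.toLin'.injective ?_
    rw [Matrix.toLin'_mul, Matrix.toLin'_toMatrix', map_zero]
    exact LinearMap.ext fun v => (e.equivFun.symm v).2
  · refine Matrix.toLin'.injective ?_
    rw [map_add, Matrix.toLin'_mul, Matrix.toLin'_mul, Matrix.toLin'_toMatrix',
      Matrix.toLin'_toMatrix', Matrix.toLin'_one]
    refine LinearMap.ext fun v => funext fun k => ?_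
    have := DFunLike.congr_fun (hB k) v
    simp only [LinearMap.sum_apply, LinearMap.smul_apply, LinearMap.comp_apply,
      LinearMap.proj_apply, Matrix.mulVecLin_apply, smul_eq_mul, LinearMap.sub_apply,
      LinearMap.id_apply, Pi.sub_apply] at this
    simp only [LinearMap.add_apply, LinearMap.comp_apply, Pi.add_apply, Matrix.toLin'_apply,
      LinearMap.id_apply]
    rw [Matrix.mulVec, dotProduct]
    simp only [Matrix.of_apply, this]
    ring

/-- Over a domain, a matrix has a kernel that splits off up to a common denominator. -/
lemma exists_kernel_splitting_of_isDomain {D ι κ : Type*} [CommRing D] [IsDomain D] [Fintype ι]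
    [Fintype κ] [DecidableEq κ] (A : Matrix ι κ D) :
    ∃ q : D, q ≠ 0 ∧
      ∃ (r : ℕ) (s : Matrix κ (Fin r) D) (t : Matrix (Fin r) κ D) (B : Matrix κ ι D),
        t * s = q • 1 ∧ A * s = 0 ∧ s * t + B * A = q • 1 := by
  let φ := algebraMap D (FractionRing D)
  have hφ : Function.Injective φ := IsFractionRing.injective _ _
  obtain ⟨r, s, t, B, hts, hAs, hst⟩ := exists_kernel_splitting (A.map φ)
  obtain ⟨⟨b, hb⟩, h⟩ := IsLocalization.exist_integer_multiples_of_finite (nonZeroDivisors D)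
    (Sum.elim (fun x : κ × Fin r => s x.1 x.2)
      (Sum.elim (fun x : Fin r × κ => t x.1 x.2) fun x : κ × ι => B x.1 x.2))
  choose c hc using h
  let s' : Matrix κ (Fin r) D := Matrix.of fun i j => c (.inl (i, j))
  let t' : Matrix (Fin r) κ D := Matrix.of fun i j => c (.inr (.inl (i, j)))
  let B' : Matrix κ ι D := Matrix.of fun i j => c (.inr (.inr (i, j)))
  have hs : s'.map φ = φ b • s := by
    ext i j; exact (hc (.inl (i, j))).trans (Algebra.smul_def _ _)
  have ht : t'.map φ = φ b • t := by
    ext i j; exact (hc (.inr (.inl (i, j)))).trans (Algebra.smul_def _ _)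
  have hB : B'.map φ = φ b • B := by
    ext i j; exact (hc (.inr (.inr (i, j)))).trans (Algebra.smul_def _ _)
  have hbB : (b • B').map φ = (φ b * φ b) • B := by
    have : (b • B').map φ = φ b • B'.map φ := by ext i j; simp
    rw [this, hB, smul_smul]
  -- The products of `s'` and `t'` carry the denominator `b` twice, so `B'` needs one extra factor
  -- `b` to match.
  refine ⟨b * b, mul_ne_zero (nonZeroDivisors.ne_zero hb) (nonZeroDivisors.ne_zero hb), r,
    s', t', b • B', Matrix.map_injective hφ ?_, Matrix.map_injective hφ ?_,
    Matrix.map_injective hφ ?_⟩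
  · beta_reduce
    rw [Matrix.map_mul, hs, ht, Matrix.smul_mul, Matrix.mul_smul, smul_smul, hts, map_smul_one,
      map_mul]
  · beta_reduce
    rw [Matrix.map_mul, hs, Matrix.mul_smul, hAs, smul_zero, Matrix.map_zero _ (map_zero φ)]
  · beta_reduce
    rw [Matrix.map_add _ (map_add φ), Matrix.map_mul, Matrix.map_mul, hs, ht, hbB, map_smul_one,
      map_mul, Matrix.smul_mul, Matrix.mul_smul, smul_smul, Matrix.smul_mul, ← smul_add, hst]

variable {K σ : Type*} [Field K]

/-- The kernels of a matrix of polynomials form a trivial bundle over a non-empty open subset of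
an irreducible variety. -/
lemma exists_generic_frame {ι κ : Type*} [Finite ι] [Fintype κ] (P : Ideal (MvPolynomial σ K))
    [P.IsPrime] (A : Matrix ι κ (MvPolynomial σ K)) :
    ∃ h ∉ P, ∃ (r : ℕ) (s : Fin r → κ → MvPolynomial σ K), ∀ z ∈ zeroLocus K P, eval z h ≠ 0 →
      LinearIndependent K (fun k β => eval z (s k β)) ∧
      (Submodule.span K (Set.range fun k β => eval z (s k β)) : Set (κ → K)) =
        {a | (A.map (eval z)).mulVec a = 0} := by
  classical
  have := Fintype.ofFinite ι
  obtain ⟨q, hq, r, s, t, B, hts, hAs, hst⟩ :=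
    exists_kernel_splitting_of_isDomain (A.map (Ideal.Quotient.mk P))
  obtain ⟨h, rfl⟩ := Ideal.Quotient.mk_surjective q
  choose s' hs' using fun i j => Ideal.Quotient.mk_surjective (s i j)
  refine ⟨h, fun hmem => hq (Ideal.Quotient.eq_zero_iff_mem.2 hmem), r, fun k β => s' β k,
    fun z hz hne => ?_⟩
  let ε : MvPolynomial σ K ⧸ P →+* K := Ideal.Quotient.lift P (eval z) fun p hp => by
    simpa [aeval_eq_eval] using hz p hp
  have hεmk (p : MvPolynomial σ K) : ε (Ideal.Quotient.mk P p) = eval z p := rfl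
  have hAε : (A.map (Ideal.Quotient.mk P)).map ε = A.map (eval z) := by ext i j; simp [hεmk]
  have hcols (v : Fin r → K) : ∑ k, v k • (fun β => eval z (s' β k)) = (s.map ε).mulVec v := by
    ext β
    simp [Matrix.mulVec, dotProduct, ← hs', hεmk, mul_comm]
  -- Where `h(z) ≠ 0`, the three specialized identities give in turn the independence of the
  -- columns, that they lie in the kernel, and that they span it.
  have hts' : t.map ε * s.map ε = eval z h • 1 := by rw [← Matrix.map_mul, hts, map_smul_one, hεmk]
  have hAs' : A.map (eval z) * s.map ε = 0 := by
    rw [← hAε, ← Matrix.map_mul, hAs, Matrix.map_zero _ (map_zero ε)]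
  have hst' : s.map ε * t.map ε + B.map ε * A.map (eval z) = eval z h • 1 := by
    rw [← hAε, ← Matrix.map_mul, ← Matrix.map_mul, ← Matrix.map_add _ (map_add ε), hst,
      map_smul_one, hεmk]
  constructor
  · rw [Fintype.linearIndependent_iff]
    intro v hv
    rw [hcols] at hv
    have := congrArg (t.map ε).mulVec hv
    rw [Matrix.mulVec_mulVec, hts', Matrix.mulVec_zero, Matrix.smul_mulVec, Matrix.one_mulVec,
      smul_eq_zero, or_iff_right hne] at this
    exact congrFun this
  · ext a
    rw [SetLike.mem_coe, Submodule.mem_span_range_iff_exists_fun]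
    constructor
    · rintro ⟨v, rfl⟩
      change (A.map (eval z)).mulVec _ = 0
      rw [hcols, Matrix.mulVec_mulVec, hAs', Matrix.zero_mulVec]
    · intro (ha : (A.map (eval z)).mulVec a = 0)
      refine ⟨(eval z h)⁻¹ • (t.map ε).mulVec a, ?_⟩
      have := congrArg (fun M => Matrix.mulVec M a) hst'
      simp only [Matrix.add_mulVec, ← Matrix.mulVec_mulVec, ha, Matrix.mulVec_zero, add_zero,
        Matrix.smul_mulVec, Matrix.one_mulVec] at this
      rw [hcols, Matrix.mulVec_smul, this, smul_smul, inv_mul_cancel₀ hne, one_smul]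

end Frame

end Deflation

namespace Deflation

variable {K : Type*} [Field K] {n d N : ℕ}

/-! ### The generic locus is dense -/

lemma eval_eq_zero_of_mem_zeroLocus {σ : Type*} {P : Ideal (MvPolynomial σ K)} {z : σ → K}
    (hz : z ∈ zeroLocus K P) {p : MvPolynomial σ K} (hp : p ∈ P) : eval z p = 0 := by
  simpa [aeval_eq_eval] using hz p hp

section AlgClosed

variable [IsAlgClosed K]

lemma mem_of_forall_eval_eq_zero {σ : Type*} [Finite σ] {P : Ideal (MvPolynomial σ K)} [P.IsPrime]
    {p : MvPolynomial σ K} (h : ∀ z ∈ zeroLocus K P, eval z p = 0) : p ∈ P := by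
  rw [← IsPrime.vanishingIdeal_zeroLocus (K := K) P]
  intro z hz
  rw [aeval_eq_eval]
  exact h z hz

lemma exists_eval_ne_zero {σ : Type*} [Finite σ] {P : Ideal (MvPolynomial σ K)} [P.IsPrime]
    {p : MvPolynomial σ K} (h : p ∉ P) : ∃ z ∈ zeroLocus K P, eval z p ≠ 0 := by
  by_contra! hz
  exact h (mem_of_forall_eval_eq_zero hz)

end AlgClosed

/-- There are finitely many associated primes; multiply elements outside `P`, one taken from each of
those not contained in `P` and `1` for the others. -/
lemma exists_notMem_component {σ : Type*} [Finite σ] (I P : Ideal (MvPolynomial σ K)) [P.IsPrime] :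
    ∃ h ∉ P, ∀ Z ∈ VAss I, ¬ zeroLocus K P ⊆ Z → ∀ y, eval y h ≠ 0 → y ∉ Z := by
  classical
  have hfin := associatedPrimes.finite (MvPolynomial σ K) (MvPolynomial σ K ⧸ I)
  have he (Q : Ideal (MvPolynomial σ K)) : ∃ e ∉ P, ¬ Q ≤ P → e ∈ Q := by
    by_cases hQ : Q ≤ P
    · exact ⟨1, (Ideal.ne_top_iff_one P).1 Ideal.IsPrime.ne_top', fun h => absurd hQ h⟩
    · obtain ⟨e, heQ, heP⟩ := SetLike.not_le_iff_exists.1 hQ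
      exact ⟨e, heP, fun _ => heQ⟩
  choose e heP heQ using he
  refine ⟨∏ Q ∈ hfin.toFinset, e Q, fun h => ?_, ?_⟩
  · obtain ⟨Q, -, hQ⟩ := (Ideal.IsPrime.prod_mem_iff).1 h
    exact heP Q hQ
  · rintro _ ⟨Q, hQ, rfl⟩ hsub y hy hyQ
    rw [map_prod, Finset.prod_ne_zero_iff] at hy
    exact hy Q (hfin.mem_toFinset.2 hQ) (eval_eq_zero_of_mem_zeroLocus hyQ
      (heQ Q fun hle => hsub (zeroLocus_anti_mono hle)))

lemma exists_isLocallyTrivialAt (f : Fin N → MvPolynomial (Fin n) K) (d : ℕ)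
    (P : Ideal (MvPolynomial (Fin n) K)) [P.IsPrime] (hfP : ∀ j, f j ∈ P) :
    ∃ h ∉ P, ∀ y ∈ zeroLocus K P, eval y h ≠ 0 → IsLocallyTrivialAt f d (zeroLocus K P) y := by
  have : Finite {α : Fin n →₀ ℕ // α.degree < d} :=
    Finite.of_injective (fun α => (⟨α.1, α.2.le⟩ : OpIndex n d)) fun α β h =>
      Subtype.ext (congrArg (fun γ : OpIndex n d => γ.1) h)
  obtain ⟨h, hP, r, s, hs⟩ := exists_generic_frame P (deflationMatrix f d)
  refine ⟨h, hP, fun y _ hyh => ⟨h, hyh, r, s, fun z hz hzh => ⟨(hs z hz hzh).1, ?_⟩⟩⟩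
  rw [(hs z hz hzh).2]
  ext a
  exact ((mem_deflatedVariety_iff f z a).trans
    (and_iff_right fun j => eval_eq_zero_of_mem_zeroLocus hz (hfP j))).symm

lemma exists_genericLocus [IsAlgClosed K] [CharZero K] (f : Fin N → MvPolynomial (Fin n) K) (d : ℕ)
    (P : Ideal (MvPolynomial (Fin n) K)) [P.IsPrime] (hfP : ∀ j, f j ∈ P) :
    ∃ h ∉ P, ∀ y ∈ zeroLocus K P, eval y h ≠ 0 → y ∈ genericLocus f d (zeroLocus K P) := by
  have hvan : vanishingIdeal K (zeroLocus K P) = P := IsPrime.vanishingIdeal_zeroLocus P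
  have : (vanishingIdeal K (zeroLocus K P)).IsPrime := by rwa [hvan]
  obtain ⟨h₁, h₁P, h₁s⟩ := exists_isSmoothPoint (zeroLocus K P)
  obtain ⟨h₂, h₂P, h₂s⟩ := exists_notMem_component (Ideal.span (Set.range f)) P
  obtain ⟨h₃, h₃P, h₃s⟩ := exists_isLocallyTrivialAt f d P hfP
  rw [hvan] at h₁P
  refine ⟨h₁ * h₂ * h₃, fun h => ?_, fun y hy hne => ?_⟩
  · rcases Ideal.IsPrime.mem_or_mem ‹_› h with h | h
    · exact (Ideal.IsPrime.mem_or_mem ‹_› h).elim h₁P h₂P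
    · exact h₃P h
  · rw [map_mul, map_mul, mul_ne_zero_iff, mul_ne_zero_iff] at hne
    exact ⟨hy, h₁s y hy hne.1.1, fun Z hZ hYZ => h₂s Z hZ hYZ y hne.1.2, h₃s y hy hne.2⟩

/-! ### The deflation of a component is irreducible -/

section Frame

variable {κ : Type*} {r : ℕ}

/-- The homomorphism `F ↦ F(x, ∑ t_k s_k(x))` from `K[x, a]` to `(K[x] ⧸ P)[t]` given by
a family `s` of sections. -/
def frameHom (P : Ideal (MvPolynomial (Fin n) K)) (s : Fin r → κ → MvPolynomial (Fin n) K) :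
    MvPolynomial (Fin n ⊕ κ) K →ₐ[K] MvPolynomial (Fin r) (MvPolynomial (Fin n) K ⧸ P) :=
  aeval (Sum.elim (fun i => C (Ideal.Quotient.mk P (X i)))
    fun β => ∑ k, X k * C (Ideal.Quotient.mk P (s k β)))

/-- Evaluation at a point, on the coordinate ring. -/
def evalQuotient {P : Ideal (MvPolynomial (Fin n) K)} {z : Fin n → K} (hz : z ∈ zeroLocus K P) :
    MvPolynomial (Fin n) K ⧸ P →+* K :=
  Ideal.Quotient.lift P (eval z) fun _ hp => eval_eq_zero_of_mem_zeroLocus hz hp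

lemma evalQuotient_mk {P : Ideal (MvPolynomial (Fin n) K)} {z : Fin n → K}
    (hz : z ∈ zeroLocus K P) (p : MvPolynomial (Fin n) K) :
    evalQuotient hz (Ideal.Quotient.mk P p) = eval z p := rfl

lemma eval_map_frameHom {P : Ideal (MvPolynomial (Fin n) K)} {z : Fin n → K}
    (hz : z ∈ zeroLocus K P) (s : Fin r → κ → MvPolynomial (Fin n) K) (t : Fin r → K)
    (F : MvPolynomial (Fin n ⊕ κ) K) :
    eval t (map (evalQuotient hz) (frameHom P s F)) =
      eval (Sum.elim z fun β => ∑ k, t k * eval z (s k β)) F := by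
  have : ((eval t).comp (map (evalQuotient hz))).comp (frameHom P s).toRingHom =
      eval (Sum.elim z fun β => ∑ k, t k * eval z (s k β)) := by
    refine MvPolynomial.ringHom_ext (fun c => ?_) fun i => ?_
    · have hc : frameHom P s (C c) = C (Ideal.Quotient.mk P (C c)) := by
        simp only [frameHom, algHom_C]
        rfl
      simp only [AlgHom.toRingHom_eq_coe, RingHom.comp_apply, RingHom.coe_coe]
      rw [hc, map_C, eval_C, evalQuotient_mk, eval_C, eval_C]
    · rcases i with i | β
      · simp [frameHom, evalQuotient_mk]
      · simp [frameHom, evalQuotient_mk, map_sum]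
  exact DFunLike.congr_fun this F

/-- `K` is infinite, so vanishing for all `t` kills every coefficient in `t` at each such `z`. A
coefficient times `h` then vanishes on all of `V(P)`, hence lies in the prime `P`, and `h` cancels.
-/
lemma mem_ker_frameHom_iff [IsAlgClosed K] (P : Ideal (MvPolynomial (Fin n) K)) [P.IsPrime]
    (s : Fin r → κ → MvPolynomial (Fin n) K) {h : MvPolynomial (Fin n) K} (hP : h ∉ P)
    (F : MvPolynomial (Fin n ⊕ κ) K) :
    F ∈ RingHom.ker (frameHom P s) ↔ ∀ z ∈ zeroLocus K P, eval z h ≠ 0 → ∀ t : Fin r → K,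
      eval (Sum.elim z fun β => ∑ k, t k * eval z (s k β)) F = 0 := by
  rw [RingHom.mem_ker]
  refine ⟨fun hF z hz _ t => ?_, fun hF => ?_⟩
  · rw [← eval_map_frameHom hz, hF, map_zero, map_zero]
  · ext m
    obtain ⟨c, hc⟩ := Ideal.Quotient.mk_surjective (coeff m (frameHom P s F))
    rw [coeff_zero, ← hc, Ideal.Quotient.eq_zero_iff_mem]
    refine (Ideal.IsPrime.mem_or_mem ‹_› (?_ : c * h ∈ P)).resolve_right hP
    refine mem_of_forall_eval_eq_zero fun z hz => ?_
    rw [map_mul]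
    by_cases hzh : eval z h = 0
    · rw [hzh, mul_zero]
    · have hzero : map (evalQuotient hz) (frameHom P s F) = 0 :=
        MvPolynomial.funext fun t => by rw [eval_map_frameHom, hF z hz hzh t, map_zero]
      rw [← evalQuotient_mk hz, hc, ← coeff_map, hzero, coeff_zero, zero_mul]

end Frame

section Irreducible

variable [IsAlgClosed K]

/-- A polynomial lies in the kernel of the homomorphism given by a frame of the deflated variety
over `Y ∩ {h ≠ 0}` if and only if it vanishes on the deflated variety over a smaller non-empty
open subset. -/
lemma mem_ker_frameHom_iff_of_frame (f : Fin N → MvPolynomial (Fin n) K)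
    (P : Ideal (MvPolynomial (Fin n) K)) [P.IsPrime] {r : ℕ}
    (s : Fin r → OpIndex n d → MvPolynomial (Fin n) K) {h h' : MvPolynomial (Fin n) K}
    (hP : h ∉ P) (hP' : h' ∉ P)
    (hs : ∀ z ∈ zeroLocus K P, eval z h ≠ 0 →
      (Submodule.span K (Set.range fun k β => eval z (s k β)) : Set (OpIndex n d → K)) =
        {a | Sum.elim z a ∈ deflatedVariety f d})
    (F : MvPolynomial (Fin n ⊕ OpIndex n d) K) :
    F ∈ RingHom.ker (frameHom P s) ↔ ∀ z ∈ zeroLocus K P, eval z h ≠ 0 → eval z h' ≠ 0 →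
      ∀ a, Sum.elim z a ∈ deflatedVariety f d → eval (Sum.elim z a) F = 0 := by
  rw [mem_ker_frameHom_iff P s
    (fun hm => (Ideal.IsPrime.mem_or_mem ‹_› hm).elim hP hP' : h * h' ∉ P)]
  simp only [map_mul, mul_ne_zero_iff, and_imp]
  refine forall₄_congr fun z hz hzh _ => ?_
  have hmem (a : OpIndex n d → K) : Sum.elim z a ∈ deflatedVariety f d ↔
      ∃ t : Fin r → K, (fun β => ∑ k, t k * eval z (s k β)) = a := by
    change a ∈ {a | Sum.elim z a ∈ deflatedVariety f d} ↔ _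
    rw [← hs z hz hzh, SetLike.mem_coe, Submodule.mem_span_range_iff_exists_fun]
    refine exists_congr fun t => ?_
    have : ∑ k, t k • (fun β => eval z (s k β)) = fun β => ∑ k, t k * eval z (s k β) := by
      ext β; simp
    rw [this]
  simp only [hmem, forall_exists_index, forall_apply_eq_imp_iff]

/-- The ideal of the part of the deflated variety over the generic locus of `Y` is prime. -/
lemma isPrime_vanishingIdeal_preimage_genericLocus [CharZero K]
    (f : Fin N → MvPolynomial (Fin n) K) (d : ℕ) (P : Ideal (MvPolynomial (Fin n) K)) [P.IsPrime] (hfP : ∀ j, f j ∈ P) :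
    (vanishingIdeal K {p | p ∈ deflatedVariety f d ∧
      proj n d p ∈ genericLocus f d (zeroLocus K P)}).IsPrime := by
  obtain ⟨h, hP, hh⟩ := exists_genericLocus f d P hfP
  obtain ⟨y, hy, hyh⟩ := exists_eval_ne_zero hP
  obtain ⟨-, -, -, h₀, hyh₀, r, s, hs⟩ := hh y hy hyh
  have hP₀ : h₀ ∉ P := fun hm => hyh₀ (eval_eq_zero_of_mem_zeroLocus hy hm)
  suffices heq : vanishingIdeal K {p | p ∈ deflatedVariety f d ∧
      proj n d p ∈ genericLocus f d (zeroLocus K P)} = RingHom.ker (frameHom P s) by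
    rw [heq]
    exact RingHom.ker_isPrime _
  ext F
  refine ⟨fun hF => ?_, fun hF => ?_⟩
  · refine (mem_ker_frameHom_iff_of_frame f P s hP₀ hP (fun z hz hne => (hs z hz hne).2) F).2
      fun z hz _ hzh a ha => ?_
    rw [← aeval_eq_eval]
    exact hF _ ⟨ha, hh z hz hzh⟩
  -- The frame `s` need not be defined at `p`. The frame near `p` yields the same kernel, because
  -- both are tested on the common open set `h₀ h₁ ≠ 0`.
  · rintro p ⟨hp, hpY, -, -, h₁, hph₁, r₁, s₁, hs₁⟩
    have hP₁ : h₁ ∉ P := fun hm => hph₁ (eval_eq_zero_of_mem_zeroLocus hpY hm)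
    have hF₁ : F ∈ RingHom.ker (frameHom P s₁) :=
      (mem_ker_frameHom_iff_of_frame f P s₁ hP₁ hP₀ (fun z hz hne => (hs₁ z hz hne).2) F).2
        fun z hz hz₁ hz₀ => (mem_ker_frameHom_iff_of_frame f P s hP₀ hP₁
          (fun z hz hne => (hs z hz hne).2) F).1 hF z hz hz₀ hz₁
    have := (mem_ker_frameHom_iff_of_frame f P s₁ hP₁ hP₁ (fun z hz hne => (hs₁ z hz hne).2) F).1
      hF₁ _ hpY hph₁ hph₁ (p ∘ Sum.inr)
    have hp' : Sum.elim (proj n d p) (p ∘ Sum.inr) = p := Sum.elim_comp_inl_inr p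
    rw [hp'] at this
    rw [aeval_eq_eval]
    exact this hp

end Irreducible

/-! ### Visibility -/

section Visible

lemma zero_section_mem_deflatedVariety (f : Fin N → MvPolynomial (Fin n) K) {x : Fin n → K}
    (hx : ∀ j, eval x (f j) = 0) : Sum.elim x (0 : OpIndex n d → K) ∈ deflatedVariety f d :=
  (mem_deflatedVariety_iff f x 0).2 ⟨hx, Matrix.mulVec_zero _⟩

lemma eval_elim_rename {κ : Type*} (x : Fin n → K) (a : κ → K) (p : MvPolynomial (Fin n) K) :
    eval (Sum.elim x a) (rename Sum.inl p) = eval x p := by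
  rw [eval_rename, Sum.elim_comp_inl]

/-- Minimal primes over `J` are associated, every associated prime contains `J`, and the
Nullstellensatz reverses inclusions of zero sets of primes. -/
lemma isIsolatedComponent_of_mem_minimalPrimes [IsAlgClosed K] {σ : Type*} [Finite σ]
    {J Q : Ideal (MvPolynomial σ K)} (hQ : Q ∈ J.minimalPrimes) :
    IsIsolatedComponent J (zeroLocus K Q) := by
  have hprime : Q.IsPrime := hQ.1.1
  refine ⟨⟨Q, ?_, rfl⟩, ?_⟩
  · refine Module.associatedPrimes.minimalPrimes_annihilator_subset_associatedPrimes _ _ ?_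
    rwa [Ideal.annihilator_quotient]
  · rintro _ ⟨Q', hQ', rfl⟩ hle
    have hprime' : Q'.IsPrime := hQ'.isPrime
    have hJ : J ≤ Q' := by
      have := hQ'.annihilator_le
      rwa [Submodule.annihilator_top, Ideal.annihilator_quotient] at this
    have hQQ : Q' ≤ Q := by
      have := vanishingIdeal_anti_mono (k := K) hle
      rwa [IsPrime.vanishingIdeal_zeroLocus, IsPrime.vanishingIdeal_zeroLocus] at this
    exact zeroLocus_anti_mono (hQ.2 ⟨hprime', hJ⟩ hQQ)

variable [CharZero K]

/-- If `p g ∈ I`, an operator at a zero of `I` with `p ≠ 0` that kills `I` kills `g`. -/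
lemma opFunctional_eq_zero_of_mul_mem (I : Ideal (MvPolynomial (Fin n) K))
    {p g : MvPolynomial (Fin n) K} (hpg : p * g ∈ I) (x : Fin n → K) (a : OpIndex n d → K)
    (hx : eval x p ≠ 0) (ha : ∀ q ∈ I, opFunctional x a q = 0) : opFunctional x a g = 0 := by
  set c : MvPolynomial (Fin n) K := C (eval x p)⁻¹ with hc
  -- The factor `1 - c p` vanishes at `x`, so its power is invisible to order `d`; that power is
  -- also `1` modulo `p`. So `p` acts as a unit for operators at `x`.
  obtain ⟨w, hw⟩ := sub_dvd_pow_sub_pow 1 (1 - c * p) (d + 1)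
  have h₁ : opFunctional x a ((1 - c * p) ^ (d + 1) * g) = 0 := by
    refine opFunctional_eq_zero_of_mem x a (Ideal.mul_mem_right _ _ (Ideal.pow_mem_pow ?_ _))
    rw [RingHom.mem_ker]
    simp [hc, hx]
  have h₂ : opFunctional x a (c * w * (p * g)) = 0 := ha _ (I.mul_mem_left _ hpg)
  have hg : g = (1 - c * p) ^ (d + 1) * g + c * w * (p * g) := by
    linear_combination g * hw
  rw [hg, map_add, h₁, h₂, add_zero]

variable [IsAlgClosed K]

lemma mem_minimalPrimes_deflationIdeal (f : Fin N → MvPolynomial (Fin n) K)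
    (P : Ideal (MvPolynomial (Fin n) K)) [P.IsPrime] (hfP : ∀ j, f j ∈ P)
    (g : MvPolynomial (Fin n) K) (hg : ∀ p ∈ P, p * g ∈ Ideal.span (Set.range f))
    (s : OpIndex n d → MvPolynomial (Fin n) K)
    (hs : ∀ p ∈ Ideal.span (Set.range f), ∑ β, s β * partialOp β.1 p ∈ P)
    (hsg : ∑ β, s β * partialOp β.1 g ∉ P) :
    vanishingIdeal K {p | p ∈ deflatedVariety f d ∧
      proj n d p ∈ genericLocus f d (zeroLocus K P)} ∈ (deflationIdeal f d).minimalPrimes := by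
  have hprime := isPrime_vanishingIdeal_preimage_genericLocus f d P hfP
  obtain ⟨h, hP, hh⟩ := exists_genericLocus f d P hfP
  set P' := vanishingIdeal K {p | p ∈ deflatedVariety f d ∧
      proj n d p ∈ genericLocus f d (zeroLocus K P)}
  have hfz {z : Fin n → K} (hz : z ∈ zeroLocus K P) (j : Fin N) : eval z (f j) = 0 :=
    eval_eq_zero_of_mem_zeroLocus hz (hfP j)
  refine ⟨⟨hprime, le_zeroLocus_iff_le_vanishingIdeal.1 fun p hp => hp.1⟩, ?_⟩
  rintro Q ⟨hQ, hJQ⟩ hQP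
  have hG {p : MvPolynomial (Fin n) K} (hp : p ∈ P) : rename Sum.inl p ∈ Q := by
    set G : MvPolynomial (Fin n ⊕ OpIndex n d) K :=
      ∑ β, X (Sum.inr β) * rename Sum.inl (partialOp β.1 g)
    have hGeval (x : Fin n → K) (a : OpIndex n d → K) :
        eval (Sum.elim x a) G = opFunctional x a g := by
      simp only [G, map_sum, map_mul, eval_X, Sum.elim_inr, eval_elim_rename, opFunctional_apply]
    have hpG : rename Sum.inl p * G ∈ Q := by
      refine (hQ.radical_le_iff.2 hJQ) ?_
      rw [← vanishingIdeal_zeroLocus_eq_radical (K := K)]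
      intro q hq
      obtain ⟨x, a, rfl⟩ : ∃ x a, q = Sum.elim x a := ⟨_, _, (Sum.elim_comp_inl_inr q).symm⟩
      rw [aeval_eq_eval, map_mul, eval_elim_rename, hGeval]
      by_cases hx : eval x p = 0
      · rw [hx, zero_mul]
      · rw [opFunctional_eq_zero_of_mul_mem _ (hg p hp) x a hx
          ((mem_deflatedVariety_iff_opFunctional f x a).1 hq).2, mul_zero]
    -- `G` is not in `Q`, since it is non-zero at the operator given by `s` over a suitable generic
    -- point of `V(P)`.
    refine (hQ.mem_or_mem hpG).resolve_right fun hGQ => ?_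
    obtain ⟨y, hy, hne⟩ := exists_eval_ne_zero
      (fun hm => (Ideal.IsPrime.mem_or_mem ‹_› hm).elim hP hsg :
        h * ∑ β, s β * partialOp β.1 g ∉ P)
    rw [map_mul, mul_ne_zero_iff] at hne
    have hop (p : MvPolynomial (Fin n) K) : opFunctional y (fun β => eval y (s β)) p =
        eval y (∑ β, s β * partialOp β.1 p) := by
      simp [opFunctional_apply, map_sum]
    have hmem : Sum.elim y (fun β => eval y (s β)) ∈ deflatedVariety f d :=
      (mem_deflatedVariety_iff_opFunctional f y _).2 ⟨hfz hy, fun p hp => by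
        rw [hop]
        exact eval_eq_zero_of_mem_zeroLocus hy (hs p hp)⟩
    have := hQP hGQ _ ⟨hmem, hh y hy hne.1⟩
    rw [aeval_eq_eval] at this
    exact hne.2 ((hop g).symm.trans ((hGeval _ _).symm.trans this))
  intro F hF
  -- The zero set of `Q` now lies over `V(P)`, so where `h ≠ 0` it lies over the generic locus,
  -- where `F` vanishes.
  have hhF : rename Sum.inl h * F ∈ Q := by
    refine mem_of_forall_eval_eq_zero fun q hq => ?_
    obtain ⟨x, a, rfl⟩ : ∃ x a, q = Sum.elim x a := ⟨_, _, (Sum.elim_comp_inl_inr q).symm⟩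
    rw [map_mul, eval_elim_rename]
    by_cases hx : eval x h = 0
    · rw [hx, zero_mul]
    · have hxP : x ∈ zeroLocus K P := fun p hp => by
        rw [aeval_eq_eval]
        exact (eval_elim_rename x a p).symm.trans (eval_eq_zero_of_mem_zeroLocus hq (hG hp))
      have := hF (Sum.elim x a) ⟨zeroLocus_anti_mono hJQ hq, hh x hxP hx⟩
      rw [aeval_eq_eval] at this
      exact mul_eq_zero_of_right _ this
  -- The zero section over a point with `h ≠ 0` shows that `h` is not in `Q`.
  refine (hQ.mem_or_mem hhF).resolve_left fun hhQ => ?_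
  obtain ⟨y, hy, hyh⟩ := exists_eval_ne_zero hP
  have := hQP hhQ _ ⟨zero_section_mem_deflatedVariety f (hfz hy), hh y hy hyh⟩
  rw [aeval_eq_eval] at this
  exact hyh ((eval_elim_rename y _ h).symm.trans this)

/-- The zero section over the dense generic locus lies in the deflation, and so does its closure,
the zero section over all of `V(P)`. Hence the image is everything, not merely dense. -/
lemma proj_image_componentDeflation (f : Fin N → MvPolynomial (Fin n) K) (d : ℕ)
    (P : Ideal (MvPolynomial (Fin n) K)) [P.IsPrime] (hfP : ∀ j, f j ∈ P) :
    proj n d '' componentDeflation f d (zeroLocus K P) = zeroLocus K P := by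
  obtain ⟨h, hP, hh⟩ := exists_genericLocus f d P hfP
  refine Set.Subset.antisymm ?_ fun y hy => ?_
  · rintro _ ⟨q, hq, rfl⟩ p hp
    have := hq (rename Sum.inl p) fun v hv => by
      rw [aeval_rename]
      exact hv.2.1 p hp
    rwa [aeval_rename] at this
  · refine ⟨Sum.elim y 0, fun F hF => ?_, Sum.elim_comp_inl y 0⟩
    set F₀ : MvPolynomial (Fin n) K := aeval (Sum.elim X 0) F with hF₀
    have heval (z : Fin n → K) : eval z F₀ = eval (Sum.elim z 0) F := by
      have : (eval z).comp (aeval (Sum.elim X 0 : Fin n ⊕ OpIndex n d →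
          MvPolynomial (Fin n) K)).toRingHom = eval (Sum.elim z 0) := by
        refine MvPolynomial.ringHom_ext (fun c => by simp) ?_
        rintro (i | β) <;> simp
      exact DFunLike.congr_fun this F
    have hmem : h * F₀ ∈ P := by
      refine mem_of_forall_eval_eq_zero fun z hz => ?_
      rw [map_mul, heval]
      by_cases hzh : eval z h = 0
      · rw [hzh, zero_mul]
      · have := hF (Sum.elim z 0) ⟨zero_section_mem_deflatedVariety f fun j =>
          eval_eq_zero_of_mem_zeroLocus hz (hfP j), hh z hz hzh⟩
        rw [aeval_eq_eval] at this
        exact mul_eq_zero_of_right _ this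
    rw [aeval_eq_eval]
    exact (heval y).symm.trans (eval_eq_zero_of_mem_zeroLocus hy
      ((Ideal.IsPrime.mem_or_mem ‹_› hmem).resolve_left hP))

end Visible

end Deflation

end

theorem theorem3p6 {K : Type*} [Field K] [IsAlgClosed K] [CharZero K] {n : ℕ}
    (I : Ideal (MvPolynomial (Fin n) K)) (Y : Set (Fin n → K)) (hY : Y ∈ Deflation.VAss I) :
    ∃ d : ℕ, ∀ (N : ℕ) (f : Fin N → MvPolynomial (Fin n) K), Ideal.span (Set.range f) = I →
      Deflation.IsVisibleAt f d Y ∧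
      Deflation.proj n d '' Deflation.componentDeflation f d Y = Y := by
  obtain ⟨P, hP, rfl⟩ := hY
  obtain ⟨hprime, x, hx⟩ := isAssociatedPrime_iff.1 hP
  obtain ⟨g, rfl⟩ := Ideal.Quotient.mk_surjective x
  have hg (u : MvPolynomial (Fin n) K) : u ∈ P ↔ u * g ∈ I := by
    rw [hx, Submodule.mem_colon_singleton, Submodule.mem_bot, ← Ideal.Quotient.eq_zero_iff_mem]
    exact Iff.rfl
  -- The order `d` comes from `I`, `P` and `g` alone, before any generators are chosen.
  obtain ⟨d, s, hs, hsg⟩ := Deflation.exists_operator_separating I P g fun u hu => (hg u).2 hu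
  refine ⟨d, fun N f hf => ?_⟩
  subst hf
  have hfP (j : Fin N) : f j ∈ P :=
    (hg _).2 (Ideal.mul_mem_right _ _ (Ideal.subset_span ⟨j, rfl⟩))
  exact ⟨Deflation.isIsolatedComponent_of_mem_minimalPrimes
    (Deflation.mem_minimalPrimes_deflationIdeal f P hfP g (fun p hp => (hg p).1 hp) s hs hsg),
    Deflation.proj_image_componentDeflation f d P hfP⟩
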